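/- Digraphs are finite, without loops and without parallel arcs (two opposite arcs between the same two vertices are allowed). A directed path has pairwise distinct vertices. For distinct vertices $x,y$ of a digraph $D$, let $\lambda_D(x,y)$ be the maximum number of pairwise arc-disjoint directed paths from $x$ to $y$, and let $\lambda(D)=\max_{x\neq y}\lambda_D(x,y)$ (with $\lambda(D)=0$ if $D$ has at most one vertex). The dichromatic number $\vec\chi(D)$ is the least $m$ such that the vertices of $D$ can be coloured with $m$ colours so that each colour class induces a subdigraph without directed cycles. For $k\ge 1$, a digraph $D$ is called $k$-extremal if its underlying undirected graph is connected and has no cutvertex, if $D$ is strong (for all vertices $x,y$ there are directed paths from $x$ to $y$ and from $y$ to $x$), and if $\vec\chi(D)=\lambda(D)+1=k+1$. **Lemma.** Let $k\ge 1$ and let $D$ be a $k$-extremal digraph. Then: 1. $D$ is Eulerian, i.e. the indegree of every vertex equals its outdegree; 2. $D$ is $(k+1)$-dicritical, i.e. $\vec\chi(D)=k+1$ and the removal of any arc yields a digraph of dichromatic number $k$; 3. $\lambda_D(x,y)=k$ for every ordered pair of distinct vertices $x,y$. In particular, call $(X,\overline X)$, where $\emptyset\neq X\subsetneq V(D)$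 and $\overline X=V(D)\setminus X$, a minimum dicut if the number of arcs from $X$ to $\overline X$ is minimum among all such $X$. If $(X,\overline X)$ is a minimum dicut, then so is $(\overline X,X)$. -/

import Mathlib

namespace Digraph

/-- `l = [x₁, …, x_p]` is a directed path with first vertex `x` and last vertex `y`: a nonempty
sequence of pairwise distinct vertices with an arc from each one to the next. -/
def IsDipath {V : Type*} (D : Digraph V) (x y : V) (l : List V) : Prop :=
  l.head? = some x ∧ l.getLast? = some y ∧ l.IsChain D.Adj ∧ l.Nodup

/-- The list of consecutive pairs `(x₁, x₂), (x₂, x₃), …` of a sequence of vertices. -/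
def arcsOf {V : Type*} (l : List V) : List (V × V) := l.zip l.tail

/-- `l = [x₁, …, x_p]` is a directed cycle `x₁ → x₂ → ⋯ → x_p → x₁`: a nonempty sequence of
pairwise distinct vertices with an arc from each one to the next and from the last to the first.
The first vertex is not repeated at the end of the list. -/
def IsDicycle {V : Type*} (D : Digraph V) (l : List V) : Prop :=
  l.IsChain D.Adj ∧ l.Nodup ∧ ∃ x y, l.head? = some x ∧ l.getLast? = some y ∧ D.Adj y x

/-- There is no directed cycle. -/
def IsAcyclic {V : Type*} (D : Digraph V) : Prop := ∀ l : List V, ¬ D.IsDicycle l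

/-- The subdigraph induced by a set of vertices. -/
def induce {V : Type*} (D : Digraph V) (S : Set V) : Digraph S where
  Adj a b := D.Adj a b

/-- The digraph `D - uv`. -/
def deleteArc {V : Type*} (D : Digraph V) (u v : V) : Digraph V where
  Adj a b := D.Adj a b ∧ ¬ (a = u ∧ b = v)

/-- Strong: between any two vertices there are dipaths in both directions. -/
def IsStrong {V : Type*} (D : Digraph V) : Prop :=
  ∀ x y : V, (∃ l, D.IsDipath x y l) ∧ ∃ l, D.IsDipath y x l

/-- The underlying graph is connected and has no cutvertex. -/
def IsBiconnected {V : Type*} (D : Digraph V) : Prop :=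
  D.toSimpleGraphInclusive.Connected ∧
    ∀ v : V, (D.toSimpleGraphInclusive.induce ({v}ᶜ : Set V)).Preconnected

/-- The outdegree equals the indegree at every vertex. -/
def IsEulerian {V : Type*} (D : Digraph V) : Prop :=
  ∀ v : V, {w | D.Adj v w}.ncard = {w | D.Adj w v}.ncard

/-- The local arc-connectivity `λ(x, y)` of two distinct vertices of a finite digraph: the maximum
number of pairwise arc-disjoint dipaths from `x` to `y`. (For `x ≠ y` every such dipath has an arc,
so that the set below is bounded by the number of arcs; the value is only meant for `x ≠ y`.) -/
noncomputable def localArcConn {V : Type*} (D : Digraph V) (x y : V) : ℕ :=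
  sSup {n | ∃ P : Fin n → List V, (∀ i, D.IsDipath x y (P i)) ∧
    ∀ i j, i ≠ j → (arcsOf (P i)).Disjoint (arcsOf (P j))}

/-- The maximum local arc-connectivity `λ(D)` of a finite digraph: the maximum of `λ(x, y)` over all
ordered pairs of distinct vertices (`0` if there is no such pair). -/
noncomputable def maxLocalArcConn {V : Type*} (D : Digraph V) : ℕ :=
  sSup {n | ∃ x y : V, x ≠ y ∧ D.localArcConn x y = n}

/-- `φ` is a `k`-dicolouring: every colour class induces an acyclic digraph. -/
def IsDicolouring {V : Type*} (D : Digraph V) (k : ℕ) (φ : V → Fin k) : Prop :=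
  ∀ i : Fin k, (D.induce (φ ⁻¹' {i})).IsAcyclic

/-- The dichromatic number of a finite loopless digraph. -/
noncomputable def dichromaticNumber {V : Type*} (D : Digraph V) : ℕ :=
  sInf {k | ∃ φ : V → Fin k, D.IsDicolouring k φ}

/-- `D` has dichromatic number `m`, and the removal of any arc yields a digraph of dichromatic
number `m - 1`. -/
def IsDicritical {V : Type*} (D : Digraph V) (m : ℕ) : Prop :=
  D.dichromaticNumber = m ∧
    ∀ u v : V, D.Adj u v → (D.deleteArc u v).dichromaticNumber + 1 = m

/-- The set `∂⁺(X)` of arcs from `X` to its complement. -/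
def outArcs {V : Type*} (D : Digraph V) (X : Set V) : Set (V × V) :=
  {a | a.1 ∈ X ∧ a.2 ∉ X ∧ D.Adj a.1 a.2}

/-- `(X, Xᶜ)` is a minimum dicut: `X` and `Xᶜ` are nonempty, and the number of arcs from `X` to `Xᶜ`
is the smallest possible. -/
def IsMinDicut {V : Type*} (D : Digraph V) (X : Set V) : Prop :=
  (X ≠ ∅ ∧ X ≠ Set.univ) ∧
    ∀ Y : Set V, Y ≠ ∅ → Y ≠ Set.univ → (D.outArcs X).ncard ≤ (D.outArcs Y).ncard

/-- `D` is biconnected, strong, and its dichromatic number is `λ(D) + 1 = k + 1`. -/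
def IsExtremal {V : Type*} (D : Digraph V) (k : ℕ) : Prop :=
  D.IsBiconnected ∧ D.IsStrong ∧
    D.dichromaticNumber = D.maxLocalArcConn + 1 ∧ D.maxLocalArcConn + 1 = k + 1

end Digraph

/-! Take an arc-minimal spanning subdigraph `H` of `D` that is not `k`-dicolourable. A cut of `H`
with fewer than `k` arcs would let dicolourings of its two sides be glued after a cyclic shift of
colours (`DiColorable.of_cut`), so every cut separating non-isolated vertices of `H` has at least
`k` arcs. If `H` missed an arc of `D`, then by `exists_ear` some arcs outside `H` would join two
distinct non-isolated vertices of `H`; every cut between these would gain an arc, and Menger's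
theorem would give `k + 1` arc-disjoint dipaths. Hence `H = D`, which yields dicriticality and, by
Menger again, all local connectivities equal to `k`. So all cuts have at least `k` arcs and any two
vertices are separated by one with at most `k`; uncrossing these cuts makes `D` Eulerian
(`excess_eq_zero`). A cut of an Eulerian digraph has equally many arcs in both directions. -/

/-- The number of arcs of `A` from `X` to its complement. -/
def cutSize {V : Type*} [DecidableEq V] (A : Finset (V × V)) (X : Finset V) : ℕ :=
  (A.filter fun a => a.1 ∈ X ∧ a.2 ∉ X).card

/-! ### Submodularity of cuts, Menger's theorem, balance. -/

section Cuts

variable {V : Type*} [DecidableEq V]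

/-- Checked arc by arc; only arcs between `X \ Y` and `Y \ X` cause strictness. -/
theorem cutSize_inter_add_cutSize_union_le (A : Finset (V × V)) (X Y : Finset V) :
    cutSize A (X ∩ Y) + cutSize A (X ∪ Y) ≤ cutSize A X + cutSize A Y := by
  simp only [cutSize, Finset.card_filter, ← Finset.sum_add_distrib]
  refine Finset.sum_le_sum fun a _ => ?_
  by_cases h1 : a.1 ∈ X <;> by_cases h2 : a.1 ∈ Y <;> by_cases h3 : a.2 ∈ X <;>
    by_cases h4 : a.2 ∈ Y <;> simp [h1, h2, h3, h4]

theorem card_filter_inter_add_union {ι : Type*} [Fintype ι] (p : ι → V) (X Y : Finset V) :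
    (Finset.univ.filter fun i => p i ∈ X ∩ Y).card + (Finset.univ.filter fun i => p i ∈ X ∪ Y).card
      = (Finset.univ.filter fun i => p i ∈ X).card + (Finset.univ.filter fun i => p i ∈ Y).card := by
  simp only [Finset.card_filter, ← Finset.sum_add_distrib]
  refine Finset.sum_congr rfl fun i _ => ?_
  by_cases h1 : p i ∈ X <;> by_cases h2 : p i ∈ Y <;> simp [h1, h2]

/-- The arc version of Menger's theorem with one path from each of a family of sources to a common
target `y`. -/
theorem exists_disjoint_routes [Finite V] {ι : Type*} [Fintype ι] [DecidableEq ι] (y : V)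
    (A : Finset (V × V)) (p : ι → V)
    (h : ∀ X : Finset V, y ∉ X → (Finset.univ.filter fun i => p i ∈ X).card ≤ cutSize A X) :
    ∃ B : ι → Finset (V × V), (∀ i, B i ⊆ A) ∧ (∀ i j, i ≠ j → Disjoint (B i) (B j)) ∧
      ∀ i, Relation.ReflTransGen (fun a b => (a, b) ∈ B i) (p i) y := by
  induction hn : A.card generalizing A p with
  | zero =>
    refine ⟨fun _ => ∅, by simp, by simp, fun i => ?_⟩
    by_cases hi : p i = y
    · rw [hi]
    · have h1 := h {p i} (by simpa using fun e => hi e.symm)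
      have h2 : 0 < (Finset.univ.filter fun j => p j ∈ ({p i} : Finset V)).card :=
        Finset.card_pos.2 ⟨i, by simp⟩
      have h3 : cutSize A {p i} = 0 := by
        rw [Finset.card_eq_zero.1 hn]; simp [cutSize]
      omega
  | succ n ih =>
    by_cases hall : ∀ i, p i = y
    · exact ⟨fun _ => ∅, by simp, by simp, fun i => by rw [hall i]⟩
    push Not at hall
    obtain ⟨i, hi⟩ := hall
    set s : Finset V → ℕ := fun X => (Finset.univ.filter fun i => p i ∈ X).card with hs
    -- Tight sets avoiding `y` and `p i` are closed under union, so the maximal one `T` contains all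
    -- of them.
    obtain ⟨T, ⟨hTy, hTi, hT⟩, hmax⟩ :=
      (Set.toFinite {T : Finset V | y ∉ T ∧ p i ∉ T ∧ cutSize A T = s T}).exists_maximal
        ⟨∅, by simp, by simp, by simp [cutSize, hs]⟩
    have hsub : ∀ Z : Finset V, y ∉ Z → p i ∉ Z → cutSize A Z = s Z → Z ⊆ T := by
      intro Z hZy hZi hZ
      have h1 := cutSize_inter_add_cutSize_union_le A T Z
      have h2 : s (T ∩ Z) + s (T ∪ Z) = s T + s Z := card_filter_inter_add_union p T Z
      have h3 : s (T ∩ Z) ≤ _ := h (T ∩ Z) (by simp [hTy])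
      have h4 : s (T ∪ Z) ≤ _ := h (T ∪ Z) (by simp [hTy, hZy])
      have h5 := hmax (y := T ∪ Z)
        ⟨by simp [hTy, hZy], by simp [hTi, hZi], by omega⟩ Finset.subset_union_left
      exact Finset.subset_union_right.trans h5
    -- Otherwise adding `p i` to `T` would add a source without enlarging the cut.
    obtain ⟨u, hu, huT⟩ : ∃ u, (p i, u) ∈ A ∧ u ∉ T := by
      by_contra! hcon
      have h1 : s (insert (p i) T) ≤ _ :=
        h (insert (p i) T) (by simp [hTy, Ne.symm hi])
      have h2 : cutSize A (insert (p i) T) ≤ cutSize A T := by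
        refine Finset.card_le_card fun a ha => ?_
        simp only [Finset.mem_filter, Finset.mem_insert] at ha ⊢
        obtain ⟨haA, h1 | h1, h2⟩ := ha
        · exact absurd (hcon a.2 (by rw [← h1]; exact haA)) (fun h => h2 (Or.inr h))
        · exact ⟨haA, h1, fun h => h2 (Or.inr h)⟩
      have h3 : s T < s (insert (p i) T) := by
        refine Finset.card_lt_card (Finset.ssubset_iff_of_subset ?_ |>.2 ⟨i, by simp, by simpa⟩)
        intro j; simp only [Finset.mem_filter, Finset.mem_insert]
        tauto
      omega
    -- Source `i` advances to `u` and the arc used is deleted. The cut condition could fail only for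
    -- a tight `X` containing `u` but not `p i`; such a set lies in `T`, which misses `u`.
    have hpos : ∀ X : Finset V, y ∉ X → (Finset.univ.filter fun j =>
        Function.update p i u j ∈ X).card ≤ cutSize (A.erase (p i, u)) X := by
      intro X hX
      have h0 : s X ≤ _ := h X hX
      have ec : cutSize A X = cutSize (A.erase (p i, u)) X + if p i ∈ X ∧ u ∉ X then 1 else 0 := by
        simp only [cutSize, Finset.card_filter]
        rw [add_comm, ← Finset.add_sum_erase A _ hu]
      have es : (Finset.univ.filter fun j => Function.update p i u j ∈ X).card +
          (if p i ∈ X then 1 else 0) = s X + if u ∈ X then 1 else 0 := by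
        simp only [hs, Finset.card_filter]
        rw [← Finset.add_sum_erase _ _ (Finset.mem_univ i),
          ← Finset.add_sum_erase _ (fun j => if p j ∈ X then 1 else 0) (Finset.mem_univ i),
          Finset.sum_congr rfl (g := fun j => if p j ∈ X then 1 else 0)]
        · simp only [Function.update_self]; ring
        · intro j hj
          rw [Function.update_of_ne (Finset.ne_of_mem_erase hj)]
      by_cases h1 : p i ∈ X <;> by_cases h2 : u ∈ X <;> simp only [h1, h2] at ec es <;>
        simp at ec es <;> try omega
      rcases h0.eq_or_lt with h3 | h3
      · exact absurd (hsub X hX h1 h3.symm h2) huT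
      · omega
    obtain ⟨B, hBA, hBd, hB⟩ := ih (A.erase (p i, u)) (Function.update p i u) hpos
      (by rw [Finset.card_erase_of_mem hu, hn]; rfl)
    have hnot : ∀ j, (p i, u) ∉ B j := fun j hj => by simpa using hBA j hj
    refine ⟨Function.update B i (insert (p i, u) (B i)), fun j => ?_, fun j l hjl => ?_,
      fun j => ?_⟩
    · rcases eq_or_ne j i with rfl | hj
      · rw [Function.update_self]
        exact Finset.insert_subset hu ((hBA j).trans (Finset.erase_subset _ _))
      · rw [Function.update_of_ne hj]
        exact (hBA j).trans (Finset.erase_subset _ _)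
    · rcases eq_or_ne j i with rfl | hj
      · rw [Function.update_self, Function.update_of_ne hjl.symm, Finset.disjoint_insert_left]
        exact ⟨hnot l, hBd j l hjl⟩
      · rw [Function.update_of_ne hj]
        rcases eq_or_ne l i with rfl | hl
        · rw [Function.update_self, Finset.disjoint_insert_right]
          exact ⟨hnot j, hBd j l hjl⟩
        · rw [Function.update_of_ne hl]
          exact hBd j l hjl
    · have h1 := hB j
      rcases eq_or_ne j i with rfl | hj
      · rw [Function.update_self] at h1 ⊢
        exact Relation.ReflTransGen.head (Finset.mem_insert_self _ _)
          (Relation.ReflTransGen.mono (fun a b hab => Finset.mem_insert_of_mem hab) _ _ h1)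
      · rw [Function.update_of_ne hj] at h1 ⊢
        exact h1

/-- Outdegree minus indegree. -/
def excess (A : Finset (V × V)) (v : V) : ℤ :=
  ∑ a ∈ A, ((if a.1 = v then 1 else 0) - if a.2 = v then 1 else 0)

/-- Arcs with both ends in `X` cancel. -/
theorem sum_excess (A : Finset (V × V)) (X : Finset V) [Fintype V] :
    ∑ v ∈ X, excess A v = cutSize A X - cutSize A Xᶜ := by
  unfold excess
  rw [Finset.sum_comm]
  simp only [cutSize, Finset.card_filter, Nat.cast_sum, ← Finset.sum_sub_distrib]
  refine Finset.sum_congr rfl fun a _ => ?_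
  rw [Finset.sum_sub_distrib, Finset.sum_ite_eq, Finset.sum_ite_eq]
  by_cases h1 : a.1 ∈ X <;> by_cases h2 : a.2 ∈ X <;> simp [h1, h2]

/-- If every cut has at least `k` arcs and any two vertices are separated in both directions by a
cut with at most `k` arcs, then all vertices are balanced. -/
theorem excess_eq_zero [Fintype V] {A : Finset (V × V)} {k : ℕ}
    (hcut : ∀ X : Finset V, X ≠ ∅ → X ≠ Finset.univ → k ≤ cutSize A X)
    (hsep : ∀ x y : V, x ≠ y → ∃ X : Finset V, x ∈ X ∧ y ∉ X ∧ cutSize A X ≤ k) (v : V) :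
    excess A v = 0 := by
  have htotal : ∑ x, excess A x = 0 := by
    rw [sum_excess]
    simp [cutSize]
  have hnonneg : ∀ s, 0 ≤ excess A s := by
    intro s
    set P : Finset V → Prop := fun X => X ≠ ∅ ∧ s ∉ X ∧ cutSize A X ≤ k with hP
    classical
    set T : Finset (Finset V) := Finset.univ.filter (Maximal P) with hT
    have hne : ∀ X : Finset V, s ∉ X → X ≠ Finset.univ := by
      rintro X h rfl; simp at h
    -- If two members meet, their intersection has cut at least `k`, so by submodularity their union
    -- has cut at most `k`, against maximality.
    have hdisj : (T : Set (Finset V)).PairwiseDisjoint id := by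
      intro X hX Y hY hXY
      simp only [hT, Finset.coe_filter, Finset.mem_univ, true_and, Set.mem_ofPred_eq] at hX hY
      by_contra hd
      have hi : X ∩ Y ≠ ∅ := fun h => hd (Finset.disjoint_iff_inter_eq_empty.2 h)
      obtain ⟨⟨hX1, hX2, hX3⟩, hXm⟩ := hX
      obtain ⟨⟨hY1, hY2, hY3⟩, hYm⟩ := hY
      have h1 := cutSize_inter_add_cutSize_union_le A X Y
      have h2 := hcut (X ∩ Y) hi (hne _ (by simp [hX2]))
      have hu : P (X ∪ Y) := ⟨by simp [hX1], by simp [hX2, hY2], by omega⟩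
      exact hXY (le_antisymm (Finset.subset_union_left.trans (hYm hu Finset.subset_union_right))
        (Finset.subset_union_right.trans (hXm hu Finset.subset_union_left)))
    have hunion : T.biUnion id = Finset.univ.erase s := by
      ext x
      simp only [Finset.mem_biUnion, id, Finset.mem_erase, Finset.mem_univ, and_true, hT,
        Finset.mem_filter, true_and]
      constructor
      · rintro ⟨X, hX, hx⟩ rfl
        exact hX.1.2.1 hx
      · intro hx
        obtain ⟨X, hxX, hsX, hX⟩ := hsep x s hx
        obtain ⟨Y, hXY, hY⟩ := (Set.toFinite {X | P X}).exists_le_maximal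
          (show P X from ⟨Finset.ne_empty_of_mem hxX, hsX, hX⟩)
        exact ⟨Y, hY, hXY hxX⟩
    -- Each part has at most `k` arcs leaving and at least `k` entering.
    have h1 : ∑ x ∈ Finset.univ.erase s, excess A x ≤ 0 := by
      rw [← hunion, Finset.sum_biUnion hdisj]
      refine Finset.sum_nonpos fun X hX => ?_
      obtain ⟨⟨hX1, hX2, hX3⟩, -⟩ := (Finset.mem_filter.1 hX).2
      have h2 := hcut Xᶜ (by simpa using hne X hX2) (by simpa using hX1)
      have h3 := sum_excess A X
      simp only [id]
      omega
    rw [← Finset.add_sum_erase _ _ (Finset.mem_univ s)] at htotal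
    omega
  exact (Finset.sum_eq_zero_iff_of_nonneg fun s _ => hnonneg s).1 htotal v (Finset.mem_univ v)

end Cuts

/-! ### Walks and paths as lists. -/

section Paths

variable {V : Type*}

/-- Built from the end: if the new first vertex already occurs, keep only the suffix starting there.
-/
theorem exists_nodup_isChain {r : V → V → Prop} {x y : V} (h : Relation.ReflTransGen r x y) :
    ∃ l : List V, l.head? = some x ∧ l.getLast? = some y ∧ l.IsChain r ∧ l.Nodup := by
  classical
  induction h using Relation.ReflTransGen.head_induction_on with
  | refl => exact ⟨[y], by simp⟩
  | @head a b hab _ ih =>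
    obtain ⟨l, hh, hl, hc, hn⟩ := ih
    by_cases ha : a ∈ l
    · obtain ⟨s, t, rfl⟩ := List.append_of_mem ha
      refine ⟨a :: t, rfl, ?_, hc.right_of_append, hn.of_append_right⟩
      rwa [List.getLast?_append_of_ne_nil _ (by simp)] at hl
    · cases l with
      | nil => simp at hh
      | cons c t =>
        obtain rfl : c = b := by simpa using hh
        exact ⟨a :: c :: t, rfl, by simpa using hl, List.isChain_cons_cons.2 ⟨hab, hc⟩,
          List.nodup_cons.2 ⟨ha, hn⟩⟩

theorem reflTransGen_of_isChain {r : V → V → Prop} {l : List V} (hc : l.IsChain r) {x y : V}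
    (hx : l.head? = some x) (hy : l.getLast? = some y) : Relation.ReflTransGen r x y := by
  induction l generalizing x with
  | nil => simp at hx
  | cons a t ih =>
    obtain rfl : a = x := by simpa using hx
    cases t with
    | nil =>
      obtain rfl : a = y := by simpa using hy
      exact .refl
    | cons b t =>
      obtain ⟨h1, h2⟩ := List.isChain_cons_cons.1 hc
      exact .head h1 (ih h2 rfl (by simpa using hy))

theorem rel_of_mem_arcsOf {r : V → V → Prop} {l : List V} (hc : l.IsChain r) {a : V × V}
    (ha : a ∈ Digraph.arcsOf l) : r a.1 a.2 := by
  induction l with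
  | nil => simp [Digraph.arcsOf] at ha
  | cons b t ih =>
    cases t with
    | nil => simp [Digraph.arcsOf] at ha
    | cons c t =>
      obtain ⟨h1, h2⟩ := List.isChain_cons_cons.1 hc
      simp only [Digraph.arcsOf, List.tail_cons, List.zip_cons_cons, List.mem_cons] at ha
      rcases ha with rfl | ha
      · exact h1
      · exact ih h2 ha

theorem arcsOf_ne_nil {l : List V} {x y : V} (hx : l.head? = some x) (hy : l.getLast? = some y)
    (hxy : x ≠ y) : Digraph.arcsOf l ≠ [] := by
  match l with
  | [] => simp at hx
  | [a] => simp at hx hy; exact absurd (hx.symm.trans hy) hxy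
  | a :: b :: t => simp [Digraph.arcsOf]

end Paths

/-! ### Dicolourings and local arc-connectivity. -/

namespace Digraph

variable {V : Type*}

/-- A colouring is a dicolouring if and only if there is no monochromatic closed walk. -/
theorem isDicolouring_iff {D : Digraph V} {k : ℕ} {φ : V → Fin k} :
    D.IsDicolouring k φ ↔ ∀ v, ¬ Relation.TransGen (fun a b => D.Adj a b ∧ φ a = φ b) v v := by
  constructor
  · intro h v hv
    obtain ⟨w, hvw, hwv⟩ := Relation.TransGen.head'_iff.1 hv
    have hlift : ∀ hw : w ∈ φ ⁻¹' {φ v},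
        Relation.ReflTransGen (D.induce (φ ⁻¹' {φ v})).Adj ⟨w, hw⟩ ⟨v, rfl⟩ := by
      clear hvw
      induction hwv using Relation.ReflTransGen.head_induction_on with
      | refl => exact fun _ => .refl
      | @head a b hab _ ih =>
        intro ha
        have hb : b ∈ φ ⁻¹' {φ v} := hab.2.symm.trans ha
        have hab' : (D.induce (φ ⁻¹' {φ v})).Adj ⟨a, ha⟩ ⟨b, hb⟩ := hab.1
        exact Relation.ReflTransGen.head hab' (ih hb)
    obtain ⟨l, hh, hl, hc, hn⟩ := exists_nodup_isChain (hlift hvw.2.symm)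
    exact h (φ v) l ⟨hc, hn, _, _, hh, hl, hvw.1⟩
  · rintro h i l ⟨hc, -, x, y, hx, hy, hyx⟩
    refine h x ?_
    have h1 := reflTransGen_of_isChain hc hx hy
    have h2 : ∀ a : (φ ⁻¹' {i} : Set V), φ a = i := fun a => a.2
    refine Relation.TransGen.tail' (b := (y : V)) ?_ ⟨hyx, (h2 _).trans (h2 _).symm⟩
    exact Relation.ReflTransGen.lift (p := fun a b => D.Adj a b ∧ φ a = φ b) Subtype.val
      (fun a b hab => ⟨hab, (h2 a).trans (h2 b).symm⟩) _ _ h1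

/-- Choosing one arc per path is injective. Boundedness matters since `sSup` of an unbounded set of
naturals is `0`. -/
theorem bddAbove_localArcConn [Finite V] (D : Digraph V) {x y : V} (hxy : x ≠ y) :
    BddAbove {n | ∃ P : Fin n → List V, (∀ i, D.IsDipath x y (P i)) ∧
      ∀ i j, i ≠ j → (arcsOf (P i)).Disjoint (arcsOf (P j))} := by
  refine ⟨Nat.card (V × V), ?_⟩
  rintro n ⟨P, hP, hd⟩
  have h1 : ∀ i, ∃ a, a ∈ arcsOf (P i) := fun i =>
    List.exists_mem_of_ne_nil _ (arcsOf_ne_nil (hP i).1 (hP i).2.1 hxy)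
  choose f hf using h1
  have hinj : Function.Injective f := by
    intro i j hij
    by_contra h
    exact hd i j h (hf i) (hij ▸ hf j)
  simpa using Nat.card_le_card_of_injective f hinj

theorem localArcConn_le_maxLocalArcConn [Finite V] (D : Digraph V) {x y : V} (hxy : x ≠ y) :
    D.localArcConn x y ≤ D.maxLocalArcConn := by
  refine le_csSup (Set.Finite.bddAbove ?_) ⟨x, y, hxy, rfl⟩
  refine (Set.finite_range fun p : V × V => D.localArcConn p.1 p.2).subset ?_
  rintro n ⟨x, y, -, rfl⟩
  exact ⟨(x, y), rfl⟩

open Classical in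
/-- The set of arcs. -/
noncomputable def arcFinset [Fintype V] (D : Digraph V) : Finset (V × V) :=
  Finset.univ.filter fun a => D.Adj a.1 a.2

theorem mem_arcFinset [Fintype V] {D : Digraph V} {a : V × V} :
    a ∈ D.arcFinset ↔ D.Adj a.1 a.2 := by
  simp [arcFinset]

/-- Menger's theorem: if all cuts from `x` to `y` have at least `n` arcs, then there are `n`
arc-disjoint dipaths. -/
theorem le_localArcConn [Fintype V] [DecidableEq V] (D : Digraph V) {x y : V} (hxy : x ≠ y)
    {n : ℕ} (h : ∀ X : Finset V, x ∈ X → y ∉ X → n ≤ cutSize D.arcFinset X) :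
    n ≤ D.localArcConn x y := by
  refine le_csSup (D.bddAbove_localArcConn hxy) ?_
  obtain ⟨B, hBA, hBd, hB⟩ := exists_disjoint_routes y D.arcFinset (fun _ : Fin n => x) (by
    intro X hX
    by_cases hx : x ∈ X
    · simpa [hx] using h X hx hX
    · simp [hx])
  choose P hh hl hc hn using fun i => exists_nodup_isChain (hB i)
  refine ⟨P, fun i => ⟨hh i, hl i, (hc i).imp fun a b hab => mem_arcFinset.1 (hBA i hab), hn i⟩,
    fun i j hij a hai haj => ?_⟩
  exact Finset.disjoint_left.1 (hBd i j hij) (rel_of_mem_arcsOf (hc i) hai)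
    (rel_of_mem_arcsOf (hc j) haj)

/-- `D` has a dicolouring with `k` colours. -/
def DiColorable (D : Digraph V) (k : ℕ) : Prop := ∃ φ : V → Fin k, D.IsDicolouring k φ

theorem DiColorable.mono_colours {D : Digraph V} {k m : ℕ} (hkm : k ≤ m) (h : D.DiColorable k) :
    D.DiColorable m := by
  obtain ⟨φ, hφ⟩ := h
  refine ⟨fun v => Fin.castLE hkm (φ v), isDicolouring_iff.2 fun v hv => ?_⟩
  refine isDicolouring_iff.1 hφ v (Relation.TransGen.mono (fun a b hab => ?_) _ _ hv)
  exact ⟨hab.1, Fin.castLE_injective hkm hab.2⟩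

theorem dichromaticNumber_eq_succ {D : Digraph V} {k : ℕ} (h1 : D.DiColorable (k + 1))
    (h2 : ¬ D.DiColorable k) : D.dichromaticNumber = k + 1 := by
  refine le_antisymm (Nat.sInf_le h1) (le_csInf ⟨_, h1⟩ fun m hm => ?_)
  by_contra! h
  exact h2 (DiColorable.mono_colours (by omega) hm)

/-- Give `u` a fresh colour of its own; the arc `uv` is then not monochromatic. -/
theorem DiColorable.of_deleteArc {D : Digraph V} (hloop : ∀ v, ¬ D.Adj v v) {k : ℕ} {u v : V}
    (h : (D.deleteArc u v).DiColorable k) : D.DiColorable (k + 1) := by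
  classical
  obtain ⟨φ, hφ⟩ := h
  refine ⟨fun x => if x = u then Fin.last k else (φ x).castSucc,
    isDicolouring_iff.2 fun x hx => isDicolouring_iff.1 hφ x
      (Relation.TransGen.mono (fun a b hab => ?_) _ _ hx)⟩
  obtain ⟨h1, h2⟩ := hab
  by_cases ha : a = u
  · by_cases hb : b = u
    · exact absurd h1 (by rw [ha, hb]; exact hloop u)
    · simp only [ha, hb, if_true, if_false] at h2
      exact absurd h2.symm (Fin.castSucc_lt_last _).ne
  · by_cases hb : b = u
    · simp only [ha, hb, if_true, if_false] at h2
      exact absurd h2 (Fin.castSucc_lt_last _).ne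
    · simp only [ha, hb, if_false] at h2
      exact ⟨⟨h1, fun h => ha h.1⟩, Fin.castSucc_injective _ h2⟩

end Digraph

/-! ### Minimal non-dicolourable subdigraphs and ears. -/

namespace Digraph

variable {V : Type*}

/-- Every digraph that is not `k`-dicolourable has an arc-minimal such spanning subdigraph. -/
theorem exists_minimal_not_diColorable [Finite V] {D : Digraph V} {k : ℕ}
    (h : ¬ D.DiColorable k) :
    ∃ H : Digraph V, (∀ a b, H.Adj a b → D.Adj a b) ∧ ¬ H.DiColorable k ∧
      ∀ H' : Digraph V, (∀ a b, H'.Adj a b → H.Adj a b) →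
        ¬ (∀ a b, H.Adj a b → H'.Adj a b) → H'.DiColorable k := by
  obtain ⟨A, hA, hmin⟩ := (Set.toFinite {A : Set (V × V) | A ⊆ {a | D.Adj a.1 a.2} ∧
    ¬ (Digraph.mk fun a b => (a, b) ∈ A).DiColorable k}).exists_minimal
      ⟨{a | D.Adj a.1 a.2}, subset_rfl, h⟩
  refine ⟨Digraph.mk fun a b => (a, b) ∈ A, fun a b hab => hA.1 hab, hA.2, fun H' h1 h2 => ?_⟩
  by_contra hH'
  have h3 : {a | H'.Adj a.1 a.2} ⊆ A := fun a ha => h1 _ _ ha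
  exact h2 fun a b hab => hmin ⟨h3.trans hA.1, hH'⟩ h3 hab

/-- If both sides of a cut are `k`-dicolourable and the cut has fewer than `k` arcs, then the whole
digraph is `k`-dicolourable. -/
theorem DiColorable.of_cut [Fintype V] [DecidableEq V] {D : Digraph V} {k : ℕ} (X : Finset V)
    (h1 : (Digraph.mk fun a b => D.Adj a b ∧ a ∈ X ∧ b ∈ X).DiColorable k)
    (h2 : (Digraph.mk fun a b => D.Adj a b ∧ a ∉ X ∧ b ∉ X).DiColorable k)
    (hX : cutSize D.arcFinset X < k) : D.DiColorable k := by
  obtain ⟨φ, hφ⟩ := h1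
  obtain ⟨ψ, hψ⟩ := h2
  rw [isDicolouring_iff] at hφ hψ
  have : NeZero k := ⟨by omega⟩
  -- Each cut arc `ab` forbids only the shift `φ a - ψ b`, and there are fewer than `k` cut arcs.
  obtain ⟨c, hc⟩ : ∃ c : Fin k, ∀ a b, D.Adj a b → a ∈ X → b ∉ X → φ a ≠ ψ b + c := by
    by_contra! hcon
    refine absurd (Finset.card_le_card_of_surjOn (s := D.arcFinset.filter
      fun a => a.1 ∈ X ∧ a.2 ∉ X) (t := Finset.univ) (fun a => φ a.1 - ψ a.2) ?_) ?_
    · intro c _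
      obtain ⟨a, b, hab, ha, hb, he⟩ := hcon c
      refine ⟨(a, b), ?_, ?_⟩
      · simpa [mem_arcFinset] using ⟨hab, ha, hb⟩
      · simp [he]
    · rw [Finset.card_univ, Fintype.card_fin]
      exact not_le.2 hX
  refine ⟨fun v => if v ∈ X then φ v else ψ v + c, isDicolouring_iff.2 fun v hv => ?_⟩
  set r : V → V → Prop := fun a b => D.Adj a b ∧
    (if a ∈ X then φ a else ψ a + c) = if b ∈ X then φ b else ψ b + c with hr
  -- No monochromatic arc leaves `X`, so a monochromatic closed walk stays on one side.
  have hclosed : ∀ a b, r a b → a ∈ X → b ∈ X := by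
    rintro a b ⟨hab, he⟩ ha
    by_contra hb
    rw [if_pos ha, if_neg hb] at he
    exact hc a b hab ha hb he
  by_cases hvX : v ∈ X
  · have key : ∀ w, Relation.TransGen r v w → w ∈ X ∧ Relation.TransGen
        (fun a b => (D.Adj a b ∧ a ∈ X ∧ b ∈ X) ∧ φ a = φ b) v w := by
      intro w hw
      induction hw with
      | @single b h =>
        have hb := hclosed _ _ h hvX
        refine ⟨hb, .single ⟨⟨h.1, hvX, hb⟩, ?_⟩⟩
        simpa [hvX, hb] using h.2
      | @tail a b _ h ih =>
        have hb := hclosed _ _ h ih.1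
        refine ⟨hb, ih.2.tail ⟨⟨h.1, ih.1, hb⟩, ?_⟩⟩
        simpa [ih.1, hb] using h.2
    exact hφ v (key v hv).2
  · have key : ∀ w, Relation.TransGen r w v → w ∉ X ∧ Relation.TransGen
        (fun a b => (D.Adj a b ∧ a ∉ X ∧ b ∉ X) ∧ ψ a = ψ b) w v := by
      intro w hw
      induction hw using Relation.TransGen.head_induction_on with
      | @single b h =>
        have hb : b ∉ X := fun hb => hvX (hclosed _ _ h hb)
        refine ⟨hb, .single ⟨⟨h.1, hb, hvX⟩, ?_⟩⟩
        simpa [hvX, hb] using h.2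
      | @head a b h _ ih =>
        have ha : a ∉ X := fun ha => ih.1 (hclosed _ _ h ha)
        refine ⟨ha, ih.2.head ⟨⟨h.1, ha, ih.1⟩, ?_⟩⟩
        simpa [ih.1, ha] using h.2
    exact hψ v (key v hv).2

/-- In an arc-minimal digraph that is not `k`-dicolourable, every cut that separates two
non-isolated vertices has at least `k` arcs. -/
theorem le_cutSize_of_minimal [Fintype V] [DecidableEq V] {H : Digraph V} {k : ℕ}
    (hH : ¬ H.DiColorable k)
    (hmin : ∀ H' : Digraph V, (∀ a b, H'.Adj a b → H.Adj a b) →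
        ¬ (∀ a b, H.Adj a b → H'.Adj a b) → H'.DiColorable k) {X : Finset V} {x y : V}
    (hxX : x ∈ X) (hyX : y ∉ X) (hx : ∃ w, H.Adj x w ∨ H.Adj w x)
    (hy : ∃ w, H.Adj y w ∨ H.Adj w y) : k ≤ cutSize H.arcFinset X := by
  by_contra! hlt
  refine hH (DiColorable.of_cut X (hmin _ (fun a b h => h.1) fun h => ?_)
    (hmin _ (fun a b h => h.1) fun h => ?_) hlt)
  · obtain ⟨w, hw | hw⟩ := hy
    · exact hyX (h _ _ hw).2.1
    · exact hyX (h _ _ hw).2.2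
  · obtain ⟨w, hw | hw⟩ := hx
    · exact (h _ _ hw).2.1 hxX
    · exact (h _ _ hw).2.2 hxX

theorem IsDipath.reflTransGen {D : Digraph V} {x y : V} {l : List V} (h : D.IsDipath x y l) :
    Relation.ReflTransGen D.Adj x y :=
  reflTransGen_of_isChain h.2.2.1 h.1 h.2.1

/-- A strong biconnected digraph has an ear outside of any proper subdigraph with at least two
vertices. -/
theorem exists_ear {D H : Digraph V} (hloop : ∀ v, ¬ D.Adj v v) (hbi : D.IsBiconnected)
    (hstrong : D.IsStrong) (hHD : ∀ a b, H.Adj a b → D.Adj a b) {p q : V} (hpq : H.Adj p q)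
    (hne : ¬ ∀ a b, D.Adj a b → H.Adj a b) :
    ∃ x y : V, x ≠ y ∧ (∃ w, H.Adj x w ∨ H.Adj w x) ∧ (∃ w, H.Adj y w ∨ H.Adj w y) ∧
      Relation.ReflTransGen (fun a b => D.Adj a b ∧ ¬ H.Adj a b) x y := by
  set S : Set V := {x | ∃ w, H.Adj x w ∨ H.Adj w x} with hS
  set E : V → V → Prop := fun a b => D.Adj a b ∧ ¬ H.Adj a b with hE
  by_contra! hcon
  replace hcon : ∀ x y, x ∈ S → y ∈ S → Relation.ReflTransGen E x y → x = y := by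
    intro x y hx hy h
    by_contra hxy
    exact hcon x y hxy hx hy h
  have hp : p ∈ S := ⟨q, Or.inl hpq⟩
  have hq : q ∈ S := ⟨p, Or.inr hpq⟩
  have hpq' : p ≠ q := by
    rintro rfl; exact hloop _ (hHD _ _ hpq)
  have hout : ∀ a b, a ∉ S → D.Adj a b → E a b := fun a b ha h =>
    ⟨h, fun h' => ha ⟨b, Or.inl h'⟩⟩
  have hin : ∀ a b, b ∉ S → D.Adj a b → E a b := fun a b hb h =>
    ⟨h, fun h' => hb ⟨a, Or.inr h'⟩⟩
  have hto : ∀ w, ∃ s ∈ S, Relation.ReflTransGen E w s := by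
    intro w
    obtain ⟨l, hl⟩ := (hstrong w p).1
    have h := hl.reflTransGen
    clear hl
    induction h using Relation.ReflTransGen.head_induction_on with
    | refl => exact ⟨p, hp, .refl⟩
    | @head a b hab _ ih =>
      by_cases ha : a ∈ S
      · exact ⟨a, ha, .refl⟩
      · obtain ⟨s, hs, h⟩ := ih
        exact ⟨s, hs, .head (hout _ _ ha hab) h⟩
  have hfrom : ∀ w, ∃ s ∈ S, Relation.ReflTransGen E s w := by
    intro w
    obtain ⟨l, hl⟩ := (hstrong w p).2
    have h := hl.reflTransGen
    clear hl
    induction h with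
    | refl => exact ⟨p, hp, .refl⟩
    | @tail a b _ hab ih =>
      by_cases hb : b ∈ S
      · exact ⟨b, hb, .refl⟩
      · obtain ⟨s, hs, h⟩ := ih
        exact ⟨s, hs, .tail h (hin _ _ hb hab)⟩
  -- If `S` were everything, an arc missing from `H` would itself be an ear.
  obtain ⟨w, hw⟩ : ∃ w, w ∉ S := by
    by_contra! hall
    push Not at hne
    obtain ⟨a, b, hab, hH⟩ := hne
    have := hcon a b (hall a) (hall b) (.single ⟨hab, hH⟩)
    exact hloop a (by rw [this] at hab ⊢; exact hab)
  obtain ⟨u, hu, huw⟩ := hfrom w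
  obtain ⟨u', hu', hwu⟩ := hto w
  obtain rfl := hcon u u' hu hu' (huw.trans hwu)
  -- Without ears, walks from `w` in `E` enter and leave `S` at the same vertex `u`. Then `W` is
  -- closed under adjacency away from `u`, and `u` separates `w` from the rest of `S`.
  set W : Set V := {z | z ≠ u ∧ Relation.ReflTransGen E u z ∧ Relation.ReflTransGen E z u} with hW
  have hWS : ∀ z ∈ W, z ∉ S := fun z hz hzS => hz.1 (hcon u z hu hzS hz.2.1).symm
  have hWstep : ∀ z z', z ∈ W → z' ≠ u → D.Adj z z' ∨ D.Adj z' z → z' ∈ W := by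
    rintro z z' hz hz' (h | h)
    · have h1 := hz.2.1.tail (hout _ _ (hWS z hz) h)
      obtain ⟨s, hs, h2⟩ := hto z'
      obtain rfl := hcon u s hu hs (h1.trans h2)
      exact ⟨hz', h1, h2⟩
    · have h1 := Relation.ReflTransGen.head (hin _ _ (hWS z hz) h) hz.2.2
      obtain ⟨s, hs, h2⟩ := hfrom z'
      obtain rfl := hcon s u hs hu (h2.trans h1)
      exact ⟨hz', h2, h1⟩
  have hwW : w ∈ W := ⟨fun h => hw (h ▸ hu), huw, hwu⟩
  obtain ⟨s, hs, hsu⟩ : ∃ s ∈ S, s ≠ u := by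
    by_cases h : p = u
    · exact ⟨q, hq, fun h' => hpq' (h.trans h'.symm)⟩
    · exact ⟨p, hp, h⟩
  have hreach := (hbi.2 u) ⟨w, hwW.1⟩ ⟨s, hsu⟩
  rw [SimpleGraph.reachable_iff_reflTransGen] at hreach
  have hall : ∀ z : ({u}ᶜ : Set V), Relation.ReflTransGen
      (D.toSimpleGraphInclusive.induce ({u}ᶜ : Set V)).Adj ⟨w, hwW.1⟩ z → (z : V) ∈ W := by
    intro z hz
    induction hz with
    | refl => exact hwW
    | @tail a b _ hab ih =>
      refine hWstep a b ih b.2 ?_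
      have := hab
      simp [Digraph.toSimpleGraphInclusive] at this
      tauto
  exact hWS s (hall _ hreach) hs

end Digraph

/-! ### Degrees and cuts in terms of arc sets; the main theorem. -/

namespace Digraph

variable {V : Type*}

theorem exists_rel_of_mem_of_notMem {r : V → V → Prop} {x y : V}
    (h : Relation.ReflTransGen r x y) {X : Finset V} (hx : x ∈ X) (hy : y ∉ X) :
    ∃ a b, r a b ∧ a ∈ X ∧ b ∉ X := by
  by_contra! hcon
  refine hy ?_
  clear hy
  induction h with
  | refl => exact hx
  | tail _ hab ih => exact hcon _ _ hab ih

theorem excess_arcFinset [Fintype V] [DecidableEq V] (D : Digraph V) (v : V) :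
    excess D.arcFinset v = {w | D.Adj v w}.ncard - {w | D.Adj w v}.ncard := by
  have h1 : {w | D.Adj v w}.ncard = (D.arcFinset.filter fun a => a.1 = v).card := by
    rw [← Set.ncard_image_of_injective _ (Prod.mk_right_injective v), ← Set.ncard_coe_finset]
    congr 1
    ext ⟨a, b⟩
    simp only [Set.mem_image, Set.mem_ofPred_eq, Prod.mk.injEq, Finset.coe_filter, mem_arcFinset]
    constructor
    · rintro ⟨w, hw, rfl, rfl⟩
      exact ⟨hw, rfl⟩
    · rintro ⟨hw, rfl⟩
      exact ⟨b, hw, rfl, rfl⟩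
  have h2 : {w | D.Adj w v}.ncard = (D.arcFinset.filter fun a => a.2 = v).card := by
    rw [← Set.ncard_image_of_injective _ (Prod.mk_left_injective v), ← Set.ncard_coe_finset]
    congr 1
    ext ⟨a, b⟩
    simp only [Set.mem_image, Set.mem_ofPred_eq, Prod.mk.injEq, Finset.coe_filter, mem_arcFinset]
    constructor
    · rintro ⟨w, hw, rfl, rfl⟩
      exact ⟨hw, rfl⟩
    · rintro ⟨hw, rfl⟩
      exact ⟨a, hw, rfl, rfl⟩
  rw [h1, h2, excess, Finset.sum_sub_distrib]
  simp only [Finset.card_filter, Nat.cast_sum, Nat.cast_ite, Nat.cast_one, Nat.cast_zero]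

theorem ncard_outArcs [Fintype V] [DecidableEq V] (D : Digraph V) (X : Finset V) :
    (D.outArcs (X : Set V)).ncard = cutSize D.arcFinset X := by
  rw [cutSize, ← Set.ncard_coe_finset]
  congr 1
  ext a
  simp only [outArcs, Finset.coe_filter, mem_arcFinset, Set.mem_ofPred_eq, Finset.mem_coe]
  tauto

end Digraph

theorem lemma4p1 {V : Type*} [Finite V] (D : Digraph V) (hloop : ∀ v : V, ¬ D.Adj v v)
    (k : ℕ) (hk : 1 ≤ k) (hD : D.IsExtremal k) :
    D.IsEulerian ∧ D.IsDicritical (k + 1) ∧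
      (∀ x y : V, x ≠ y → D.localArcConn x y = k) ∧
      ∀ X : Set V, D.IsMinDicut X → D.IsMinDicut Xᶜ := by
  classical
  have := Fintype.ofFinite V
  obtain ⟨hbi, hstrong, hchi, hmax⟩ := hD
  have hle : ∀ x y : V, x ≠ y → D.localArcConn x y ≤ k := fun x y hxy => by
    have := D.localArcConn_le_maxLocalArcConn hxy
    omega
  have hnot : ¬ D.DiColorable k := fun h => by
    have : D.dichromaticNumber ≤ k := Nat.sInf_le h
    omega
  obtain ⟨H, hHD, hHk, hmin⟩ := Digraph.exists_minimal_not_diColorable hnot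
  obtain ⟨p, q, hpq⟩ : ∃ p q, H.Adj p q := by
    by_contra! hcon
    refine hHk ⟨fun _ => ⟨0, hk⟩, Digraph.isDicolouring_iff.2 fun v hv => ?_⟩
    obtain ⟨w, hw, -⟩ := Relation.TransGen.head'_iff.1 hv
    exact hcon _ _ hw.1
  have hDH : ∀ a b, D.Adj a b → H.Adj a b := by
    by_contra hne
    obtain ⟨x, y, hxy, hx, hy, hE⟩ :=
      Digraph.exists_ear hloop hbi hstrong hHD hpq hne
    have h1 : k + 1 ≤ D.localArcConn x y := by
      refine D.le_localArcConn hxy fun X hxX hyX => ?_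
      -- The ear crosses the cut by an arc outside `H`, which makes the inequality strict.
      refine (Digraph.le_cutSize_of_minimal hHk hmin hxX hyX hx hy).trans_lt ?_
      obtain ⟨a, b, ⟨hab, hnab⟩, ha, hb⟩ := Digraph.exists_rel_of_mem_of_notMem hE hxX hyX
      refine Finset.card_lt_card (Finset.ssubset_iff_of_subset ?_ |>.2 ⟨(a, b), ?_, ?_⟩)
      · refine Finset.filter_subset_filter _ fun e he => ?_
        exact Digraph.mem_arcFinset.2 (hHD _ _ (Digraph.mem_arcFinset.1 he))
      · simp [Digraph.mem_arcFinset, hab, ha, hb]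
      · simp [Digraph.mem_arcFinset, hnab]
    have := hle x y hxy
    omega
  obtain rfl : H = D := by
    cases H; cases D
    congr
    funext a b
    exact propext ⟨hHD a b, hDH a b⟩
  have hpq' : p ≠ q := by
    rintro rfl
    exact hloop _ hpq
  have hnonisol : ∀ v, ∃ w, H.Adj v w ∨ H.Adj w v := by
    intro v
    obtain ⟨t, ht⟩ : ∃ t, v ≠ t := by
      by_cases h : v = p
      · exact ⟨q, h ▸ hpq'⟩
      · exact ⟨p, h⟩
    obtain ⟨l, hl⟩ := (hstrong v t).1
    rcases Relation.ReflTransGen.cases_head hl.reflTransGen with h | ⟨w, hw, -⟩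
    · exact absurd h ht
    · exact ⟨w, Or.inl hw⟩
  have hcut : ∀ (X : Finset V) (x y : V), x ∈ X → y ∉ X → k ≤ cutSize H.arcFinset X :=
    fun X x y hx hy =>
      Digraph.le_cutSize_of_minimal hHk hmin hx hy (hnonisol x) (hnonisol y)
  have hexc : ∀ v, excess H.arcFinset v = 0 := by
    refine excess_eq_zero (k := k) (fun X h1 h2 => ?_) fun x y hxy => ?_
    · obtain ⟨x, hx⟩ := Finset.nonempty_iff_ne_empty.2 h1
      obtain ⟨y, hy⟩ : ∃ y, y ∉ X := by
        by_contra! h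
        exact h2 (Finset.eq_univ_iff_forall.2 h)
      exact hcut X x y hx hy
    · by_contra! hcon
      have h1 : k + 1 ≤ H.localArcConn x y := H.le_localArcConn hxy hcon
      have := hle x y hxy
      omega
  refine ⟨fun v => ?_, ⟨by omega, fun u v huv => ?_⟩, fun x y hxy => ?_, fun X hX => ?_⟩
  · have h1 := H.excess_arcFinset v
    rw [hexc v] at h1
    omega
  · have hcol : (H.deleteArc u v).DiColorable k :=
      hmin _ (fun a b h => h.1) fun h => (h u v huv).2 ⟨rfl, rfl⟩
    -- An `m`-dicolouring of the digraph without `uv` would give a dicolouring of the whole with `m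
    -- + 1 = k` colours.
    obtain ⟨m, rfl⟩ : ∃ m, k = m + 1 := ⟨k - 1, by omega⟩
    rw [Digraph.dichromaticNumber_eq_succ hcol fun h => hnot (h.of_deleteArc hloop)]
  · exact le_antisymm (hle x y hxy) (H.le_localArcConn hxy fun X hx hy => hcut X x y hx hy)
  · have hbal : (H.outArcs Xᶜ).ncard = (H.outArcs X).ncard := by
      have h1 := sum_excess H.arcFinset X.toFinset
      rw [Finset.sum_eq_zero fun v _ => hexc v, ← H.ncard_outArcs, ← H.ncard_outArcs] at h1
      simp only [Finset.coe_compl, Set.coe_toFinset] at h1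
      omega
    refine ⟨⟨?_, ?_⟩, fun Y hY1 hY2 => hbal ▸ hX.2 Y hY1 hY2⟩
    · simpa [Set.compl_empty_iff] using hX.1.2
    · simpa [Set.compl_univ_iff] using hX.1.1
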